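/- \textbf{Setting.} Let $A$ be a finite dimensional algebra over a field $k$ which is symmetric, i.e. $A\cong \operatorname{Hom}_k(A,k)$ as $A$-bimodules. Modules are right $A$-modules, $K(A)$ is the homotopy category of complexes of $A$-modules, and $K^b(\operatorname{proj}A)\subseteq K(A)$ is the full subcategory of objects isomorphic to bounded complexes of finitely generated projective $A$-modules. A complex $T\in K^b(\operatorname{proj}A)$ is \emph{partial tilting} if $\operatorname{Hom}_{K(A)}(T,T[n])=0$ for all $n\neq 0$; it is \emph{tilting} if moreover the smallest triangulated subcategory of $K(A)$ which contains $T$ and is closed under direct summands contains $K^b(\operatorname{proj}A)$. The \emph{length} of a complex $X$ is $\max\{n: H^n(X)\ne0\}-\min\{n: H^n(X)\neq 0\}+1$. For an object $P$, $\operatorname{add}P$ denotes the class of direct summands of finite direct sums of copies of $P$. \textbf{Construction.} Let $P\in K^b(\operatorname{proj}A)$ be a partial tilting complex of length $r+1$ and let $s=\max\{n:H^n(P)\ne0\}$. Put $\Delta_0(P,A)=A$ (in degree $0$). For $n\ge1$, choose $P_n\in\operatorname{add}P$ and a morphism $g_n':P_n\to\Delta_{n-1}(P,A)[r-s-n+1]$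 such that $\operatorname{Hom}_{K(A)}(P,g_n')$ is a projective cover of right $\operatorname{End}_{K(A)}(P)$-modules (so $P_n=0$ if its target is $0$), put $g_n=g_n'[n+s-r-1]$, and let $\Delta_n(P,A)$ be a cone of $g_n$, i.e. choose a distinguished triangle $$P_n[n+s-r-1]\xrightarrow{\,g_n\,}\Delta_{n-1}(P,A)\to\Delta_n(P,A)\to P_n[n+s-r].$$ Put $\Theta_n(P,A)=\Delta_n(P,A)\oplus P[n+s-r]$. \textbf{Corollary.} Let $P\in K^b(\operatorname{proj}A)$ be a partial tilting complex of length $2$ (so $r=1$). Then for every $n\ge1$ the construction of $\Theta_n(P,A)$ can be carried out, and whatever choices are made, $\Theta_n(P,A)$ is a tilting complex. In particular, $P$ extends to a tilting complex: there is $Q\in K^b(\operatorname{proj}A)$ such that $P\oplus Q$ is a tilting complex. -/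

import Mathlib

open CategoryTheory CategoryTheory.Limits CategoryTheory.Pretriangulated

universe u v w

/-- A `k`-algebra `A` is symmetric if `A ≅ DA = Hom_k(A, k)` as `A`-bimodules, where `DA` has the
bimodule structure `(a • f • b) y = f (b * y * a)`. -/
def IsSymmetricAlg (k : Type v) (A : Type u) [Field k] [Ring A] [Algebra k A] : Prop :=
  ∃ φ : A ≃ₗ[k] Module.Dual k A, ∀ a x b y : A, φ (a * x * b) y = φ x (b * y * a)

/-- A projective cover `f : Q → M`: a surjection from a projective module whose kernel is
superfluous. -/
def IsProjectiveCover {R : Type u} {Q : Type v} {M : Type w} [Ring R] [AddCommGroup Q] [Module R Q]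
    [AddCommGroup M] [Module R M] (f : Q →ₗ[R] M) : Prop :=
  Module.Projective R Q ∧ Function.Surjective f ∧
    ∀ N : Submodule R Q, N ⊔ LinearMap.ker f = ⊤ → N = ⊤

section Triangulated

variable {C : Type u} [Category.{v} C] [Preadditive C] [HasZeroObject C] [HasShift C ℤ]
  [∀ n : ℤ, (shiftFunctor C n).Additive] [Pretriangulated C]

/-- `InAdd P Q`: the object `Q` lies in `add P`, i.e. it is (isomorphic to) a direct summand of a
finite direct sum of copies of `P`. -/
def InAdd (P Q : C) : Prop :=
  ∃ m : ℕ, Nonempty (Retract Q (⨁ fun _ : Fin m => P))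

/-- `IsDelta P s r M n X`: the object `X` is a possible value of `Δₙ(P, M)`.

* `Δ₀(P, M) = M`.
* `Δₙ₊₁(P, M)` is a cone of `g = g'[n+s-r] : Q[n+s-r] ⟶ Δₙ(P, M)`, where `Q ∈ add P` and
  `g' : Q ⟶ Δₙ(P, M)[r-s-n]` induces a projective cover
  `Hom(P, Q) ⟶ Hom(P, Δₙ(P, M)[r-s-n])` of right `End(P)`-modules.

If `Hom(P, Δₙ(P, M)[r-s-n]) = 0` the cover condition says that `Hom(P, Q) = 0`, that is `Q = 0`.
(Composition in `End P` is written so that `f ≫ g` is `g * f`, hence `(End P)ᵐᵒᵖ`-modules are right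
modules over the usual endomorphism ring, acting by precomposition.) -/
inductive IsDelta (P : C) (s r : ℤ) (M : C) : ℕ → C → Prop
  | zero : IsDelta P s r M 0 M
  | succ (n : ℕ) (X Y Q : C) (hX : IsDelta P s r M n X) (hQ : InAdd P Q)
      (g' : Q ⟶ X⟦r - s - (n : ℤ)⟧)
      (hg' : IsProjectiveCover ((preadditiveCoyonedaObj P).map g').hom)
      (g : Q⟦(n : ℤ) + s - r⟧ ⟶ X)
      (hg : g = g'⟦(n : ℤ) + s - r⟧' ≫
        (shiftFunctorCompIsoId C (r - s - (n : ℤ)) ((n : ℤ) + s - r) (by ring)).hom.app X)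
      (h : X ⟶ Y) (δ : Y ⟶ Q⟦(n : ℤ) + s - r⟧⟦(1 : ℤ)⟧)
      (hT : Triangle.mk g h δ ∈ distTriang C) :
      IsDelta P s r M (n + 1) Y

/-- `IsTheta P s r M n T`: the object `T` is a possible value of
`Θₙ(P, M) = Δₙ(P, M) ⊕ P[n+s-r]`. -/
def IsTheta (P : C) (s r : ℤ) (M : C) (n : ℕ) (T : C) : Prop :=
  ∃ X : C, IsDelta P s r M n X ∧ T = (X ⊞ P⟦(n : ℤ) + s - r⟧)

end Triangulated

section Complexes

variable (A : Type u) [Ring A]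

/-- Cochain complexes of right `A`-modules (right `A`-modules are `Aᵐᵒᵖ`-modules). -/
abbrev Cplx := CochainComplex (ModuleCat.{u} Aᵐᵒᵖ) ℤ

/-- The homotopy category `K(A)` of cochain complexes of right `A`-modules. -/
abbrev KCat := HomotopyCategory (ModuleCat.{u} Aᵐᵒᵖ) (ComplexShape.up ℤ)

variable {A}

/-- The object of `K(A)` given by a complex. -/
abbrev Cplx.toK (X : Cplx A) : KCat A :=
  (HomotopyCategory.quotient (ModuleCat.{u} Aᵐᵒᵖ) (ComplexShape.up ℤ)).obj X

variable (A) in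
/-- The regular right module `A`, as a complex concentrated in degree `0`. -/
noncomputable abbrev regularCplx : Cplx A :=
  (CochainComplex.singleFunctor (ModuleCat.{u} Aᵐᵒᵖ) 0).obj (ModuleCat.of Aᵐᵒᵖ A)

/-- `X` is a bounded complex of finitely generated projective right `A`-modules. -/
def IsBoundedProj (X : Cplx A) : Prop :=
  (∃ a b : ℤ, ∀ i : ℤ, i < a ∨ b < i → IsZero (X.X i)) ∧
    ∀ i : ℤ, Module.Finite Aᵐᵒᵖ (X.X i) ∧ Module.Projective Aᵐᵒᵖ (X.X i)

variable (A) in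
/-- The (strictly full) subcategory `K^b(proj A)` of `K(A)`. -/
def KbProj : ObjectProperty (KCat A) :=
  fun T => ∃ X : Cplx A, IsBoundedProj X ∧ Nonempty (T ≅ X.toK)

/-- A partial tilting complex: `T ∈ K^b(proj A)` and `Hom(T, T[n]) = 0` for all `n ≠ 0`. -/
def IsPartialTilting (T : KCat A) : Prop :=
  KbProj A T ∧ ∀ n : ℤ, n ≠ 0 → ∀ f : T ⟶ T⟦n⟧, f = 0

/-- A tilting complex: a partial tilting complex `T` which generates `K^b(proj A)`, that is,
`K^b(proj A)` is contained in the smallest triangulated subcategory of `K(A)` that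
contains `T` and is closed under direct summands. -/
def IsTilting (T : KCat A) : Prop :=
  IsPartialTilting T ∧ KbProj A ≤ (ObjectProperty.singleton T).triangEnvelope

/-- The degrees in which the cohomology of `X` does not vanish. -/
def cohomologySupport (X : Cplx A) : Set ℤ :=
  {n : ℤ | ¬ IsZero (X.homology n)}

/-- `HasLength X l`: the complex `X` has length
`l = max {n | Hⁿ(X) ≠ 0} - min {n | Hⁿ(X) ≠ 0} + 1`. -/
def HasLength (X : Cplx A) (l : ℤ) : Prop :=
  ∃ a b : ℤ, IsLeast (cohomologySupport X) a ∧ IsGreatest (cohomologySupport X) b ∧ l = b - a + 1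

end Complexes

/-! The engine is a weak Calabi–Yau property: over a symmetric algebra, `Hom(X, Y) = 0` forces
`Hom(Y, X) = 0` in `K^b(proj A)` (`KbProj.hom_eq_zero_symm`), so every vanishing statement has to be
checked on one side only.

Since `Hom(A, P[j])` is `H^j(P)`, a complex `P` of length 2 with top degree `s` has `Hom(A, P[j]) =
0` unless `j` is `s - 1` or `s`; dually `Hom(P, A[j]) = 0` unless `j` is `-s` or `1 - s`. Passing to
the cone of the cover kills the upper of these degrees, because the cover is surjective on `Hom(P,
-)`, and can create maps only one degree lower. Hence for `n ≥ 1` the groups `Hom(P, Δₙ[j])` live in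
the single degree `1 - s - n`, which is the one matched by the summand `P[n+s-1]` of `Θₙ`. The
triangles then give `Hom(Δₙ, Δₙ[j]) = 0` for `j > 0`, and duality gives `j < 0`. All this is carried
inductively by `IsDelta.invariants`. Running the triangles backwards recovers `A` from `P` and `Δₙ`,
and `A` generates `K^b(proj A)` (`kbProj_le_of_regularCplx`).

The construction never gets stuck because Hom spaces are finite dimensional and idempotents split in
`K^b(proj A)`: a surjection onto `Hom(P, X)` coming from `add P` with smallest source is a
projective cover (`exists_projectiveCover`). -/

/-! ### Vanishing of Hom groups along triangles, and the induction on `n`. -/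

section HomZero

set_option linter.unusedSectionVars false

variable {C : Type u} [Category.{v} C] [Preadditive C] [HasZeroObject C] [HasShift C ℤ]
  [∀ n : ℤ, (shiftFunctor C n).Additive] [Pretriangulated C]

/-- All morphisms from `X` to `Y⟦i⟧` vanish. -/
def HomZero (X Y : C) (i : ℤ) : Prop := ∀ f : X ⟶ Y⟦i⟧, f = 0

theorem homs_eq_zero_of_iso {X X' Y Y' : C} (e : X ≅ X') (e' : Y ≅ Y')
    (h : ∀ f : X ⟶ Y, f = 0) (f : X' ⟶ Y') : f = 0 := by
  have := h (e.hom ≫ f ≫ e'.inv)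
  rw [← cancel_epi e.hom, ← cancel_mono e'.inv]
  simpa using this

theorem homs_eq_zero_shift_iff {X Y : C} (a : ℤ) :
    (∀ f : X⟦a⟧ ⟶ Y⟦a⟧, f = 0) ↔ ∀ f : X ⟶ Y, f = 0 := by
  constructor
  · intro h f
    exact (shiftFunctor C a).map_injective (by rw [h ((shiftFunctor C a).map f), Functor.map_zero])
  · intro h f
    obtain ⟨g, rfl⟩ := (shiftFunctor C a).map_surjective f
    rw [h g, Functor.map_zero]

theorem HomZero.of_iso {X X' Y Y' : C} {i : ℤ} (h : HomZero X Y i) (e : X ≅ X') (e' : Y ≅ Y') :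
    HomZero X' Y' i :=
  homs_eq_zero_of_iso e ((shiftFunctor C i).mapIso e') h

theorem homZero_shift_right_iff {X Y : C} {b i c : ℤ} (h : b + i = c) :
    HomZero X (Y⟦b⟧) i ↔ HomZero X Y c :=
  ⟨fun H ↦ homs_eq_zero_of_iso (Iso.refl _) ((shiftFunctorAdd' C b i c h).symm.app Y) H,
    fun H ↦ homs_eq_zero_of_iso (Iso.refl _) ((shiftFunctorAdd' C b i c h).app Y) H⟩

theorem homZero_shift_left_iff {X Y : C} {a i c : ℤ} (h : c + a = i) :
    HomZero (X⟦a⟧) Y i ↔ HomZero X Y c := by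
  have : HomZero (X⟦a⟧) Y i ↔ ∀ f : X⟦a⟧ ⟶ Y⟦c⟧⟦a⟧, f = 0 :=
    ⟨fun H ↦ homs_eq_zero_of_iso (Iso.refl _) ((shiftFunctorAdd' C c a i h).app Y) H,
      fun H ↦ homs_eq_zero_of_iso (Iso.refl _) ((shiftFunctorAdd' C c a i h).symm.app Y) H⟩
  rw [this, homs_eq_zero_shift_iff]
  rfl

theorem homZero_zero_iff {X Y : C} : HomZero X Y 0 ↔ ∀ f : X ⟶ Y, f = 0 :=
  ⟨fun H ↦ homs_eq_zero_of_iso (Iso.refl _) ((shiftFunctorZero C ℤ).app Y) H,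
    fun H ↦ homs_eq_zero_of_iso (Iso.refl _) ((shiftFunctorZero C ℤ).symm.app Y) H⟩

theorem homs_shift_eq_zero_iff {X Y : C} {a c : ℤ} (h : c + a = 0) :
    (∀ f : X⟦a⟧ ⟶ Y, f = 0) ↔ HomZero X Y c := by
  rw [← homZero_zero_iff, homZero_shift_left_iff h]

theorem HomZero.obj₃_right {T : Triangle C} (hT : T ∈ distTriang C) {Z : C} {i : ℤ}
    (h₁ : HomZero Z T.obj₁ (i + 1)) (h₂ : HomZero Z T.obj₂ i) : HomZero Z T.obj₃ i := by
  intro f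
  obtain ⟨g, hg⟩ := Triangle.coyoneda_exact₃ _ (Triangle.shift_distinguished T hT i) f
    ((homZero_shift_right_iff rfl).2 h₁ _)
  have hg0 : g = 0 := h₂ g
  rw [hg, hg0]
  exact zero_comp

theorem HomZero.obj₃_left {T : Triangle C} (hT : T ∈ distTriang C) {Z : C} {i : ℤ}
    (h₁ : HomZero (T.obj₁⟦(1 : ℤ)⟧) Z i) (h₂ : HomZero T.obj₂ Z i) : HomZero T.obj₃ Z i := by
  intro f
  obtain ⟨g, hg⟩ := Triangle.yoneda_exact₃ _ hT f (h₂ _)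
  rw [hg, h₁ g, comp_zero]

theorem HomZero.biprod_left {X Y Z : C} {i : ℤ} (h₁ : HomZero X Z i) (h₂ : HomZero Y Z i) :
    HomZero (X ⊞ Y) Z i := by
  intro f
  apply biprod.hom_ext'
  · rw [h₁ (biprod.inl ≫ f), comp_zero]
  · rw [h₂ (biprod.inr ≫ f), comp_zero]

theorem HomZero.biprod_right {X Y Z : C} {i : ℤ} (h₁ : HomZero Z X i) (h₂ : HomZero Z Y i) :
    HomZero Z (X ⊞ Y) i := by
  intro f
  rw [← Category.comp_id f, ← CategoryTheory.Functor.map_id, ← biprod.total, Functor.map_add, Functor.map_comp,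
    Functor.map_comp, Preadditive.comp_add, ← Category.assoc, ← Category.assoc,
    h₁ (f ≫ _), h₂ (f ≫ _), zero_comp, zero_comp, add_zero]

theorem inAdd_iff {P Q : C} : InAdd P Q ↔
    ∃ (m : ℕ) (a : Fin m → (Q ⟶ P)) (b : Fin m → (P ⟶ Q)), ∑ j, a j ≫ b j = 𝟙 Q := by
  constructor
  · rintro ⟨m, ⟨r⟩⟩
    refine ⟨m, fun j ↦ r.i ≫ biproduct.π _ j, fun j ↦ biproduct.ι (fun _ : Fin m ↦ P) j ≫ r.r, ?_⟩
    calc ∑ j, (r.i ≫ biproduct.π _ j) ≫ biproduct.ι (fun _ : Fin m ↦ P) j ≫ r.r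
        = r.i ≫ (∑ j, biproduct.π _ j ≫ biproduct.ι (fun _ : Fin m ↦ P) j) ≫ r.r := by
          simp only [Preadditive.sum_comp, Preadditive.comp_sum, Category.assoc]
      _ = 𝟙 Q := by rw [biproduct.total, Category.id_comp, r.retract]
  · rintro ⟨m, a, b, h⟩
    refine ⟨m, ⟨⟨biproduct.lift a, biproduct.desc b, ?_⟩⟩⟩
    rw [biproduct.lift_desc, h]

theorem InAdd.homZero_left {P Q Y : C} {i : ℤ} (hQ : InAdd P Q) (h : HomZero P Y i) :
    HomZero Q Y i := by
  obtain ⟨m, a, b, hab⟩ := inAdd_iff.1 hQ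
  intro f
  rw [← Category.id_comp f, ← hab, Preadditive.sum_comp]
  exact Finset.sum_eq_zero fun j _ ↦ by rw [Category.assoc, h (b j ≫ f), comp_zero]

theorem InAdd.homZero_right {P Q Y : C} {i : ℤ} (hQ : InAdd P Q) (h : HomZero Y P i) :
    HomZero Y Q i := by
  obtain ⟨m, a, b, hab⟩ := inAdd_iff.1 hQ
  intro f
  rw [← Category.comp_id f, ← CategoryTheory.Functor.map_id, ← hab, Functor.map_sum, Preadditive.comp_sum]
  exact Finset.sum_eq_zero fun j _ ↦ by
    rw [Functor.map_comp, ← Category.assoc, h (f ≫ _), zero_comp]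

theorem InAdd.prop {S : ObjectProperty C} [S.IsTriangulated] [S.IsStableUnderRetracts] {P Q : C}
    (hQ : InAdd P Q) (hP : S P) : S Q := by
  obtain ⟨m, ⟨r⟩⟩ := hQ
  have := ObjectProperty.IsClosedUnderFiniteProducts.mk' (P := S)
  exact S.prop_of_retract (r.trans (.ofIso (biproduct.isoProduct _))) (S.prop_product fun _ ↦ hP)

/-- The invariants carried along the construction of `Δₙ(P, M)` for `r = 1`. -/
theorem IsDelta.invariants {K : ObjectProperty C} [K.IsTriangulated] [K.IsStableUnderRetracts]
    (hK : ∀ X Y : C, K X → K Y → (∀ f : X ⟶ Y, f = 0) → ∀ f : Y ⟶ X, f = 0)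
    {P M : C} {s : ℤ} (hP : K P) (hM : K M) (hPP : ∀ j, j ≠ 0 → HomZero P P j)
    (hMM : ∀ j, j ≠ 0 → HomZero M M j)
    (hPM : ∀ j, j ≠ 1 - s → j ≠ -s → HomZero P M j) {n : ℕ} {X : C} (hX : IsDelta P s 1 M n X) :
    K X ∧ (∀ j, j ≠ 0 → HomZero X X j) ∧
      (∀ j, j ≠ 1 - s - n → (n = 0 → j ≠ -s) → HomZero P X j) ∧
      ∀ S : ObjectProperty C, S.IsTriangulated → S.IsStableUnderRetracts → S P → S X → S M := by
  have dual : ∀ {X Y : C}, K X → K Y → ∀ {i j : ℤ}, i + j = 0 → HomZero X Y i → HomZero Y X j := by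
    intro X Y hX hY i j hij h
    rw [← homs_shift_eq_zero_iff hij] at h
    exact hK _ _ (K.le_shift j _ hX) hY h
  induction hX with
  | zero =>
    exact ⟨hM, hMM, fun j h₁ h₂ ↦ hPM j (by simpa using h₁) (h₂ rfl), fun S _ _ _ h ↦ h⟩
  | succ n X Y Q hX hQ g' hg' g hg h δ hT ih =>
    obtain ⟨hKX, hXX, hPX, hgen⟩ := ih
    have hKQ : K Q := hQ.prop hP
    have hKY : K Y := K.ext_of_isTriangulatedClosed₃ _ hT (K.le_shift _ _ hKQ) hKX
    -- The only degree that can survive moves down by one: surjectivity of the cover kills degree `1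
    -- - s - n`, and `Q` contributes to the cone only in degree `-s - n`.
    have hPY : ∀ j, j ≠ -s - n → HomZero P Y j := by
      intro j hj
      by_cases hj' : j = 1 - s - n
      · rw [← homs_shift_eq_zero_iff (a := (n : ℤ) + s - 1) (by lia)]
        -- As `Hom(P, Q[1]) = 0`, the map `f` lifts to `X`; the lift factors through `g` by
        -- surjectivity of the cover, so it dies in the cone.
        intro f
        obtain ⟨u, hu⟩ := Triangle.coyoneda_exact₃ _ hT f
          ((homZero_shift_left_iff (c := 1 - (n + s - 1)) (by lia)).2
            ((homZero_shift_right_iff (c := 1) (by lia)).2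
              (hQ.homZero_right (hPP 1 (by lia)))) _)
        change P⟦(n : ℤ) + s - 1⟧ ⟶ X at u
        change f = u ≫ h at hu
        obtain ⟨w, hw⟩ := (shiftFunctor C ((n : ℤ) + s - 1)).map_surjective (u ≫
          (shiftFunctorCompIsoId C (1 - s - (n : ℤ)) ((n : ℤ) + s - 1) (by ring)).inv.app X)
        obtain ⟨v, hv⟩ : ∃ v : P ⟶ Q, v ≫ g' = w := hg'.2.1 w
        have hu' : u = v⟦(n : ℤ) + s - 1⟧' ≫ g := by
          rw [hg, ← Category.assoc, ← Functor.map_comp, hv, hw, Category.assoc,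
            Iso.inv_hom_id_app]
          exact (Category.comp_id _).symm
        have hgh : g ≫ h = 0 := comp_distTriang_mor_zero₁₂ _ hT
        rw [hu, hu', Category.assoc, hgh, comp_zero]
      · refine HomZero.obj₃_right hT ?_ (hPX j hj' fun h ↦ ?_)
        · exact (homZero_shift_right_iff rfl).2 (hQ.homZero_right (hPP _ (by lia)))
        -- The second exceptional degree `-s` occurs only for `n = 0`, where it coincides with the
        -- excluded degree `-s - n`.
        · subst h; simpa using hj
    -- The obstruction `Hom(X, Q[n+s+j])` is dual to `Hom(Q, X[-(n+s+j)])`, and for `j > 0` this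
    -- degree lies below all exceptional ones.
    have hXY : ∀ j, 0 < j → HomZero X Y j := by
      intro j hj
      refine HomZero.obj₃_right hT ?_ (hXX j hj.ne')
      exact (homZero_shift_right_iff rfl).2 (hQ.homZero_right
        (dual hP hKX (i := -(n + s - 1 + (j + 1))) (by lia) (hPX _ (by lia) (by lia))))
    have hYY : ∀ j, 0 < j → HomZero Y Y j := by
      intro j hj
      refine HomZero.obj₃_left hT ?_ (hXY j hj)
      refine (homZero_shift_left_iff (c := j - 1) (by lia)).2 ?_
      exact (homZero_shift_left_iff (c := j - 1 - (n + s - 1)) (by lia)).2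
        (hQ.homZero_left (hPY _ (by lia)))
    refine ⟨hKY, fun j hj ↦ ?_, fun j hj _ ↦ hPY j fun h ↦ hj (by push_cast; lia),
      fun S _ _ hSP hSY ↦ hgen S ‹_› ‹_› hSP ?_⟩
    -- Only positive degrees come from the triangles; negative ones follow by duality.
    · rcases lt_or_gt_of_ne hj with hj | hj
      · exact dual hKY hKY (i := -j) (by lia) (hYY _ (by lia))
      · exact hYY j hj
    · exact S.ext_of_isTriangulatedClosed₂ _ hT (S.le_shift _ _ (hQ.prop hSP)) hSY

end HomZero

/-! ### Fitting idempotents and existence of projective covers. -/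

open Polynomial in
/-- An element of a finite-dimensional algebra has a polynomial expression `r` in it that is
idempotent, with `r 0 = 0` and `r 1 = 1`. -/
theorem exists_isIdempotentElem_aeval {k : Type*} {B : Type*} [Field k] [Ring B] [Algebra k B]
    {φ : B} (hφ : IsIntegral k φ) :
    ∃ r : k[X], IsIdempotentElem (aeval φ r) ∧ X ∣ r ∧ (X - 1) ∣ (r - 1) := by
  obtain ⟨p, hp, hp0⟩ := hφ
  have hp0 : aeval φ p = 0 := hp0
  -- The factor `X - 1` is inserted so that it divides `q`, whence `r ≡ 1` modulo `X - 1`. The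
  -- exponent `N + 1` below, instead of `N`, ensures `X ∣ r` even when `N = 0`.
  obtain ⟨q, hq, hq'⟩ := (p * (X - 1)).exists_eq_pow_rootMultiplicity_mul_and_not_dvd
    (mul_ne_zero hp.ne_zero (by simpa using X_sub_C_ne_zero (1 : k))) 0
  generalize rootMultiplicity 0 (p * (X - 1)) = N at hq
  rw [C_0, sub_zero] at hq hq'
  have hcop : IsCoprime (X ^ (N + 1)) q :=
    ((prime_X.coprime_iff_not_dvd).2 hq').pow_left
  obtain ⟨a, b, hab⟩ := hcop
  refine ⟨a * X ^ (N + 1), ?_, ⟨a * X ^ N, by ring⟩, ?_⟩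
  · have h0 : aeval φ (X ^ (N + 1) * q) = 0 := by
      have : X ^ (N + 1) * q = X * (X - 1) * p := by rw [pow_succ', mul_assoc, ← hq]; ring
      rw [this, map_mul, hp0, mul_zero]
    have h1 : a * X ^ (N + 1) * (1 - a * X ^ (N + 1)) = a * b * (X ^ (N + 1) * q) := by
      rw [← hab]; ring
    have h2 := congrArg (aeval φ) h1
    rw [map_mul, map_mul (aeval φ) (a * b), h0, mul_zero, map_sub, map_one, mul_sub, mul_one,
      sub_eq_zero] at h2
    exact h2.symm
  · have hdvd : (X - 1 : k[X]) ∣ q := by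
      have h1 : IsCoprime (X - 1 : k[X]) (X ^ N) :=
        IsCoprime.pow_right ⟨-1, 1, by ring⟩
      exact h1.dvd_of_dvd_mul_left (hq ▸ Dvd.intro_left p rfl)
    have : a * X ^ (N + 1) - 1 = - (b * q) := by rw [← hab]; ring
    rw [this]
    exact (hdvd.mul_left b).neg_right

section Cover

variable {k : Type w} [Field k] {C : Type u} [Category.{v} C] [Preadditive C] [Linear k C]

open Polynomial in
theorem exists_isIdempotentElem_aeval_end {Q : C} [FiniteDimensional k (Q ⟶ Q)] (φ : End Q) :
    ∃ r : k[X], IsIdempotentElem (aeval φ r) ∧ X ∣ r ∧ (X - 1) ∣ (r - 1) :=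
  have : FiniteDimensional k (End Q) := ‹_›
  exists_isIdempotentElem_aeval (Algebra.IsIntegral.isIntegral φ)

-- Take `f = r(φ)` for the Fitting polynomial `r`. Since `φ` acts on `g` as the identity and `r(1) =
-- 1`, also `f` fixes `g`; since `X ∣ r`, the equation `f = 1` exhibits an inverse of `φ`.
open Polynomial in
theorem exists_idempotent_of_comp_eq {Q X : C} [FiniteDimensional k (Q ⟶ Q)] (g : Q ⟶ X)
    (φ : End Q) (hφ : φ ≫ g = g) :
    ∃ f : Q ⟶ Q, f ≫ f = f ∧ f ≫ g = g ∧ (f = 𝟙 Q → IsIso φ) := by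
  obtain ⟨r, hr, ⟨a, ha⟩, ⟨b, hb⟩⟩ := exists_isIdempotentElem_aeval_end (k := k) φ
  refine ⟨aeval φ r, hr, ?_, fun h ↦ ?_⟩
  · have h1 : aeval φ r = 1 + (φ - 1) * aeval φ b := by
      have := congrArg (aeval φ) hb
      simp only [map_sub, map_mul, map_one, aeval_X] at this
      rw [← this, add_sub_cancel]
    have h2 : ∀ t ψ : Q ⟶ Q, ψ ≫ g = g → (𝟙 Q + t ≫ (ψ - 𝟙 Q)) ≫ g = g := fun t ψ h ↦ by
      simp [h]
    rw [h1]
    exact h2 _ _ hφ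
  · have h : aeval φ r = 1 := h
    have h1 : φ * aeval φ a = 1 := by simpa [ha] using h
    have h2 : aeval φ a * φ = 1 := by
      rw [ha, mul_comm] at h
      simpa using h
    exact ⟨aeval φ a, h2, h1⟩

end Cover

section Cover

set_option linter.unusedSectionVars false

variable {C : Type u} [Category.{v} C] [Preadditive C] [HasZeroObject C] [HasShift C ℤ]
  [∀ n : ℤ, (shiftFunctor C n).Additive] [Pretriangulated C]

theorem InAdd.of_retract {P Q Q' : C} (h : InAdd P Q) (r : Retract Q' Q) : InAdd P Q' := by
  obtain ⟨m, ⟨r'⟩⟩ := h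
  exact ⟨m, ⟨r.trans r'⟩⟩

theorem sum_comp_comp_eq {P Q : C} {m : ℕ} {a : Fin m → (Q ⟶ P)} {b : Fin m → (P ⟶ Q)}
    (hab : ∑ j, a j ≫ b j = 𝟙 Q) (x : P ⟶ Q) : ∑ j, (x ≫ a j) ≫ b j = x := by
  simp only [Category.assoc, ← Preadditive.comp_sum, hab, Category.comp_id]

theorem InAdd.projective {P Q : C} (h : InAdd P Q) :
    Module.Projective (End P)ᵐᵒᵖ ((preadditiveCoyonedaObj P).obj Q) := by
  obtain ⟨m, a, b, hab⟩ := inAdd_iff.1 h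
  let i : ((preadditiveCoyonedaObj P).obj Q) →ₗ[(End P)ᵐᵒᵖ] (Fin m → (End P)ᵐᵒᵖ) :=
    LinearMap.pi fun j ↦
      { toFun := fun x : P ⟶ Q ↦ MulOpposite.op (x ≫ a j : End P)
        map_add' := fun x y : P ⟶ Q ↦ by
          rw [← MulOpposite.op_add]; exact congrArg MulOpposite.op (Preadditive.add_comp _ _ _ x y _)
        map_smul' := fun c (x : P ⟶ Q) ↦ congrArg MulOpposite.op
          (Category.assoc (c.unop : P ⟶ P) x (a j)) }
  let p : (Fin m → (End P)ᵐᵒᵖ) →ₗ[(End P)ᵐᵒᵖ] ((preadditiveCoyonedaObj P).obj Q) :=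
    Fintype.linearCombination _ fun j ↦ (b j : (preadditiveCoyonedaObj P).obj Q)
  refine Module.Projective.of_split i p (LinearMap.ext fun x ↦ ?_)
  exact sum_comp_comp_eq hab x

variable {k : Type w} [Field k] [Linear k C]

/-- Minimality of `dim Hom(P, Q)` among surjecting `Q ∈ add P` makes `g` right minimal: every `φ`
with `φ ≫ g = g` is invertible, since otherwise a Fitting idempotent splits off a smaller `Q`. Right
minimality in turn makes the kernel superfluous. -/
theorem exists_projectiveCover {P X : C} [FiniteDimensional k (P ⟶ X)]
    (hfin : ∀ Q : C, InAdd P Q → FiniteDimensional k (Q ⟶ Q))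
    (hfin' : ∀ Q : C, InAdd P Q → FiniteDimensional k (P ⟶ Q))
    (hsplit : ∀ (Q : C) (e : Q ⟶ Q), InAdd P Q → e ≫ e = e →
      ∃ (Y : C) (i : Y ⟶ Q) (p : Q ⟶ Y), i ≫ p = 𝟙 Y ∧ p ≫ i = e) :
    ∃ (Q : C) (g : Q ⟶ X), InAdd P Q ∧
      IsProjectiveCover ((preadditiveCoyonedaObj P).map g).hom := by
  classical
  have hex : ∃ (d : ℕ) (Q : C) (g : Q ⟶ X), InAdd P Q ∧ (∀ w : P ⟶ X, ∃ v : P ⟶ Q, v ≫ g = w) ∧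
      Module.finrank k (P ⟶ Q) = d := by
    -- One copy of `P` for each element of a `k`-basis of `Hom(P, X)` already gives a surjection.
    let β := Module.finBasis k (P ⟶ X)
    refine ⟨_, ⨁ fun _ : Fin (Module.finrank k (P ⟶ X)) ↦ P, biproduct.desc β,
      ⟨_, ⟨Retract.refl _⟩⟩, fun w ↦ ⟨biproduct.lift fun j ↦ β.repr w j • 𝟙 P, ?_⟩, rfl⟩
    rw [biproduct.lift_desc]
    simp [β.sum_repr w]
  obtain ⟨Q, g, hQ, hg, hd⟩ := Nat.find_spec hex
  have hmin : ∀ (Q' : C) (g' : Q' ⟶ X), InAdd P Q' → (∀ w : P ⟶ X, ∃ v : P ⟶ Q', v ≫ g' = w) →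
      Module.finrank k (P ⟶ Q) ≤ Module.finrank k (P ⟶ Q') := fun Q' g' h h' ↦
    hd ▸ Nat.find_min' hex ⟨Q', g', h, h', rfl⟩
  obtain ⟨m, a, b, hab⟩ := inAdd_iff.1 hQ
  have := hfin Q hQ
  have := hfin' Q hQ
  have hiso : ∀ φ : Q ⟶ Q, φ ≫ g = g → IsIso φ := by
    intro φ hφ
    obtain ⟨f, hf, hfg, hfφ⟩ := exists_idempotent_of_comp_eq (k := k) g φ hφ
    apply hfφ
    obtain ⟨Y, i, p, hip, hpi⟩ := hsplit Q f hQ hf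
    have hY : InAdd P Y := hQ.of_retract ⟨i, p, hip⟩
    have := hfin' Y hY
    let L : (P ⟶ Y) →ₗ[k] (P ⟶ Q) := Linear.rightComp k P i
    have hL : Function.Injective L := fun x y hxy ↦ by
      have hxy : x ≫ i = y ≫ i := hxy
      rw [← Category.comp_id x, ← Category.comp_id y, ← hip, ← Category.assoc, hxy,
        Category.assoc]
    have hrank : Module.finrank k (P ⟶ Y) = Module.finrank k (P ⟶ Q) := by
      refine le_antisymm (LinearMap.finrank_le_finrank_of_injective hL)
        (hmin Y (i ≫ g) hY fun w ↦ ?_)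
      obtain ⟨v, hv⟩ := hg w
      refine ⟨v ≫ p, ?_⟩
      rw [Category.assoc, ← Category.assoc p, hpi, hfg, hv]
    -- By equality of dimensions every map `P ⟶ Q` factors through the image of `f`; as the `b j`
    -- jointly cover `Q`, this forces `f = 1`.
    have hb : ∀ j, b j ≫ f = b j := fun j ↦ by
      obtain ⟨x, hx⟩ := (LinearMap.injective_iff_surjective_of_finrank_eq_finrank hrank).1 hL (b j)
      have hx : x ≫ i = b j := hx
      rw [← hx, ← hpi, Category.assoc, ← Category.assoc i, hip, Category.id_comp]
    rw [← Category.id_comp f, ← hab, Preadditive.sum_comp]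
    exact Finset.sum_congr rfl fun j _ ↦ by rw [Category.assoc, hb]
  refine ⟨Q, g, hQ, hQ.projective, hg, fun N hN ↦ ?_⟩
  -- Replacing each `b j` by an element of `N` with the same image under `g` turns `∑ a j ≫ b j = 1`
  -- into an endomorphism fixing `g`, hence an automorphism. Its inverse writes every element as a
  -- combination of the `x j`, so `N` is everything.
  have hdec : ∀ j, ∃ x : P ⟶ Q, x ∈ N ∧ x ≫ g = b j ≫ g := fun j ↦ by
    let b' : (preadditiveCoyonedaObj P).obj Q := b j
    obtain ⟨x, hx, y, hy, hxy⟩ := Submodule.mem_sup.1 (hN ▸ Submodule.mem_top (x := b'))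
    have key : ∀ x y : P ⟶ Q, y ≫ g = 0 → x + y = b j → x ≫ g = b j ≫ g := by
      intro x y hy hxy
      rw [← hxy, Preadditive.add_comp, hy, add_zero]
    exact ⟨x, hx, key x y hy hxy⟩
  choose x hxN hxg using hdec
  have hφ : (∑ j, a j ≫ x j) ≫ g = g := by
    rw [Preadditive.sum_comp, Finset.sum_congr rfl fun j _ ↦ by rw [Category.assoc, hxg j],
      ← Finset.sum_congr rfl fun j _ ↦ Category.assoc (a j) (b j) g, ← Preadditive.sum_comp, hab,
      Category.id_comp]
  have := hiso _ hφ
  refine (Submodule.eq_top_iff').2 fun y ↦ ?_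
  let x' : Fin m → (preadditiveCoyonedaObj P).obj Q := x
  let c : Fin m → (End P)ᵐᵒᵖ := fun j ↦
    MulOpposite.op (((y : P ⟶ Q) ≫ inv (∑ j, a j ≫ x j)) ≫ a j)
  have hy : y = ∑ j, c j • x' j := by
    have key : ∀ y : P ⟶ Q, y = ∑ j, ((y ≫ inv (∑ j, a j ≫ x j)) ≫ a j) ≫ x j := by
      intro y
      simp only [Category.assoc, ← Preadditive.comp_sum, IsIso.inv_hom_id, Category.comp_id]
    exact key y
  rw [hy]
  exact N.sum_mem fun j _ ↦ N.smul_mem _ (hxN j)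

end Cover

/-! ### Finitely generated projective modules. -/

section Modules

variable {R : Type u} [Ring R]

/-- Finitely generated projective modules. -/
def FGProj (M : ModuleCat.{u} R) : Prop := Module.Finite R M ∧ Module.Projective R M

theorem FGProj.of_retract {M N : ModuleCat.{u} R} (h : FGProj N) (r : Retract M N) : FGProj M := by
  obtain ⟨h₁, h₂⟩ := h
  have hr : r.r.hom ∘ₗ r.i.hom = LinearMap.id := by
    rw [← ModuleCat.hom_comp, r.retract, ModuleCat.hom_id]
  exact ⟨Module.Finite.of_surjective r.r.hom fun x ↦ ⟨r.i.hom x, LinearMap.congr_fun hr x⟩,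
    Module.Projective.of_split r.i.hom r.r.hom hr⟩

theorem FGProj.biprod {M N : ModuleCat.{u} R} (hM : FGProj M) (hN : FGProj N) :
    FGProj (M ⊞ N) := by
  obtain ⟨h₁, h₂⟩ := hM
  obtain ⟨h₃, h₄⟩ := hN
  have : FGProj (ModuleCat.of R (M × N)) := ⟨inferInstanceAs (Module.Finite R (M × N)),
    inferInstanceAs (Module.Projective R (M × N))⟩
  exact this.of_retract (.ofIso (ModuleCat.biprodIsoProd M N))

theorem FGProj.of_isZero {M : ModuleCat.{u} R} (h : IsZero M) : FGProj M := by
  have := ModuleCat.subsingleton_of_isZero h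
  have : Module.Free R M := .of_subsingleton R M
  exact ⟨inferInstance, .of_free⟩

variable (R) in
/-- The regular module. -/
def regMod : ModuleCat.{u} R := ModuleCat.of R R

/-- A finitely generated projective module is a direct summand of a finite free module. -/
theorem FGProj.exists_dual_basis {M : ModuleCat.{u} R} (hM : FGProj M) :
    ∃ (m : ℕ) (ξ : Fin m → (M ⟶ regMod R)) (x : Fin m → (regMod R ⟶ M)),
      ∑ j, ξ j ≫ x j = 𝟙 M := by
  obtain ⟨h₁, h₂⟩ := hM
  obtain ⟨m, f, g, hf, hg, hfg⟩ := Module.Finite.exists_comp_eq_id_of_projective R M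
  refine ⟨m, fun j ↦ ModuleCat.ofHom (LinearMap.proj j ∘ₗ g),
    fun j ↦ ModuleCat.ofHom (f ∘ₗ LinearMap.single R (fun _ ↦ R) j), ?_⟩
  ext y
  rw [ModuleCat.hom_sum, LinearMap.sum_apply]
  change ∑ j, f (Pi.single j (g y j)) = y
  rw [← map_sum, Finset.univ_sum_single]
  exact LinearMap.congr_fun hfg y

variable {k : Type v} [Field k] [Algebra k R] [FiniteDimensional k R]

open scoped ModuleCat in
theorem FGProj.finiteDimensional_hom {M N : ModuleCat.{u} R} (hM : FGProj M) (hN : FGProj N) :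
    FiniteDimensional k (M ⟶ N) := by
  obtain ⟨hM, -⟩ := hM
  obtain ⟨hN, -⟩ := hN
  let _ : Module k N := ModuleCat.moduleOfAlgebraModule N
  have : IsScalarTower k R N := ModuleCat.isScalarTower_of_algebra_moduleCat N
  have : Module.Finite k N := Module.Finite.trans R N
  obtain ⟨n, s, hs⟩ := Module.Finite.exists_fin (R := R) (M := M)
  let L : (M ⟶ N) →ₗ[k] (Fin n → N) :=
    { toFun := fun f i ↦ f.hom (s i)
      map_add' := fun f g ↦ rfl
      map_smul' := fun c f ↦ rfl }
  refine FiniteDimensional.of_injective L fun f g h ↦ ?_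
  ext1
  exact LinearMap.ext_on_range hs fun i ↦ congrFun h i

end Modules

/-! ### `K^b(proj A)`: triangulated, Hom-finite, idempotent complete. -/

section KbProj

variable {A : Type u} [Ring A]

theorem IsBoundedProj.fgProj {X : Cplx A} (hX : IsBoundedProj X) (i : ℤ) : FGProj (X.X i) := hX.2 i

theorem IsBoundedProj.of_retract {X Y : Cplx A} (hY : IsBoundedProj Y) (r : Retract X Y) :
    IsBoundedProj X := by
  obtain ⟨⟨a, b, h⟩, h'⟩ := hY
  have r' := fun i ↦ r.map (HomologicalComplex.eval _ _ i)
  refine ⟨⟨a, b, fun i hi ↦ ?_⟩, fun i ↦ FGProj.of_retract (h' i) (r' i)⟩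
  have : Retract (X.X i) (Y.X i) := r' i
  rw [IsZero.iff_id_eq_zero, ← this.retract, (h i hi).eq_of_tgt this.i 0, zero_comp]

theorem IsBoundedProj.shift {X : Cplx A} (hX : IsBoundedProj X) (n : ℤ) :
    IsBoundedProj (X⟦n⟧) := by
  obtain ⟨⟨a, b, h⟩, h'⟩ := hX
  exact ⟨⟨a - n, b - n, fun i hi ↦ h (i + n) (by lia)⟩, fun i ↦ h' (i + n)⟩

theorem IsBoundedProj.mappingCone {X Y : Cplx A} (hX : IsBoundedProj X) (hY : IsBoundedProj Y)
    (φ : X ⟶ Y) : IsBoundedProj (CochainComplex.mappingCone φ) := by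
  obtain ⟨⟨a, b, h⟩, h'⟩ := hX
  obtain ⟨⟨c, d, h₁⟩, h₁'⟩ := hY
  refine ⟨⟨min a c - 1, max b d + 1, fun i hi ↦ ?_⟩, fun i ↦ ?_⟩
  · rw [CochainComplex.mappingCone.isZero_X_iff]
    exact ⟨h _ (by lia), h₁ _ (by lia)⟩
  · exact (FGProj.biprod (h' (i + 1)) (h₁' i)).of_retract
      (.ofIso (HomologicalComplex.homotopyCofiber.XIsoBiprod φ i (i + 1) rfl))

theorem IsBoundedProj.kbProj {X : Cplx A} (hX : IsBoundedProj X) : KbProj A X.toK :=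
  ⟨X, hX, ⟨Iso.refl _⟩⟩

instance : (KbProj A).IsClosedUnderIsomorphisms where
  of_iso := by
    rintro T T' e ⟨X, hX, ⟨e'⟩⟩
    exact ⟨X, hX, ⟨e.symm ≪≫ e'⟩⟩

instance : (KbProj A).IsStableUnderShift ℤ where
  isStableUnderShiftBy n :=
    { le_shift := by
        rintro T ⟨X, hX, ⟨e⟩⟩
        exact ⟨X⟦n⟧, hX.shift n, ⟨(shiftFunctor _ n).mapIso e ≪≫
          (((HomotopyCategory.quotient _ _).commShiftIso n).app X).symm⟩⟩ }

open scoped ZeroObject in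
instance : (KbProj A).ContainsZero where
  exists_zero := by
    have h : ∀ i, IsZero ((0 : Cplx A).X i) := fun i ↦
      (HomologicalComplex.eval _ _ i).map_isZero (isZero_zero _)
    exact ⟨Cplx.toK 0, (HomotopyCategory.quotient _ _).map_isZero (isZero_zero _),
      IsBoundedProj.kbProj ⟨⟨0, 0, fun i _ ↦ h i⟩, fun i ↦ FGProj.of_isZero (h i)⟩⟩

instance : (KbProj A).IsTriangulatedClosed₃ :=
  .mk' fun T hT h₁ h₂ ↦ by
    obtain ⟨X, hX, ⟨e₁⟩⟩ := h₁
    obtain ⟨Y, hY, ⟨e₂⟩⟩ := h₂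
    obtain ⟨φ, hφ⟩ := (HomotopyCategory.quotient _ _).map_surjective (e₁.inv ≫ T.mor₁ ≫ e₂.hom)
    refine ⟨_, hX.mappingCone hY φ, ⟨?_⟩⟩
    exact Triangle.π₃.mapIso (isoTriangleOfIso₁₂ T (CochainComplex.mappingCone.triangleh φ) hT
      ⟨_, _, φ, ⟨Iso.refl _⟩⟩ e₁ e₂ (by
        change _ = e₁.hom ≫ (HomotopyCategory.quotient _ _).map φ
        rw [hφ, Iso.hom_inv_id_assoc]; rfl))

instance : (KbProj A).IsTriangulated where
  toIsTriangulatedClosed₂ := .of_isTriangulatedClosed₃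

variable {k : Type v} [Field k] [Algebra k A] [FiniteDimensional k A]

variable (k) in
theorem IsBoundedProj.finiteDimensional_hom {X Y : Cplx A} (hX : IsBoundedProj X)
    (hY : IsBoundedProj Y) : FiniteDimensional k (X ⟶ Y) := by
  obtain ⟨⟨a, b, h⟩, h'⟩ := hX
  have (i : ℤ) : FiniteDimensional k (X.X i ⟶ Y.X i) :=
    FGProj.finiteDimensional_hom (h' i) (hY.2 i)
  let L : (X ⟶ Y) →ₗ[k] (∀ i : Finset.Icc a b, (X.X i ⟶ Y.X i)) :=
    { toFun := fun f i ↦ f.f i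
      map_add' := fun f g ↦ rfl
      map_smul' := fun c f ↦ rfl }
  refine FiniteDimensional.of_injective L fun f g hfg ↦ ?_
  ext1 i
  by_cases hi : i ∈ Finset.Icc a b
  · exact congrFun hfg ⟨i, hi⟩
  · exact (h i (by rw [Finset.mem_Icc] at hi; lia)).eq_of_src _ _

variable (k) in
theorem KbProj.finiteDimensional_hom {T T' : KCat A} (hT : KbProj A T) (hT' : KbProj A T') :
    FiniteDimensional k (T ⟶ T') := by
  obtain ⟨X, hX, ⟨e⟩⟩ := hT
  obtain ⟨Y, hY, ⟨e'⟩⟩ := hT'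
  have := hX.finiteDimensional_hom k hY
  have : FiniteDimensional k (X.toK ⟶ Y.toK) :=
    Module.Finite.of_surjective ((HomotopyCategory.quotient _ _).mapLinearMap k)
      (HomotopyCategory.quotient _ _).map_surjective
  refine Module.Finite.of_surjective (Linear.leftComp k T' e.hom ∘ₗ Linear.rightComp k _ e'.inv)
    fun f ↦ ⟨e.inv ≫ f ≫ e'.hom, ?_⟩
  simp

-- On an idempotent, a polynomial depends only on its values at `0` and `1`. This lets the Fitting
-- polynomial of a chain-level lift fix the idempotent being lifted.
open Polynomial in
theorem aeval_eq_of_isIdempotentElem {B : Type*} [Ring B] [Algebra k B] {e : B}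
    (he : IsIdempotentElem e) {r : k[X]} (h₀ : X ∣ r) (h₁ : (X - 1) ∣ (r - 1)) :
    aeval e r = e := by
  obtain ⟨a, rfl⟩ := h₀
  obtain ⟨b, hb⟩ := h₁
  have h : e * (aeval e (X * a) - 1) = 0 := by
    have := congrArg (aeval e) hb
    rw [map_sub, map_one, map_mul (aeval e) (X - 1 : k[X]), map_sub, map_one, aeval_X] at this
    rw [this, ← mul_assoc, mul_sub, mul_one, he.eq, sub_self, zero_mul]
  rw [mul_sub, mul_one, map_mul, aeval_X, ← mul_assoc, he.eq, sub_eq_zero] at h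
  rw [map_mul, aeval_X, h]

open Polynomial in
/-- Idempotents of bounded complexes of finitely generated projectives split in `K(A)`. -/
theorem IsBoundedProj.exists_split (k : Type v) [Field k] [Algebra k A]
    [FiniteDimensional k A] {X : Cplx A} (hX : IsBoundedProj X) (e : X.toK ⟶ X.toK)
    (he : e ≫ e = e) : ∃ (Y : Cplx A) (_ : IsBoundedProj Y) (i : Y.toK ⟶ X.toK)
      (p : X.toK ⟶ Y.toK), i ≫ p = 𝟙 _ ∧ p ≫ i = e := by
  let F := HomotopyCategory.quotient (ModuleCat.{u} Aᵐᵒᵖ) (ComplexShape.up ℤ)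
  -- A lift `φ` of `e` is idempotent only up to homotopy; `r(φ)` is strictly idempotent, still lifts
  -- `e`, and splits in the category of complexes.
  obtain ⟨φ, hφ⟩ : ∃ φ : End X, F.map φ = e := F.map_surjective e
  have : FiniteDimensional k (X ⟶ X) := hX.finiteDimensional_hom k hX
  let Φ : End X →ₐ[k] End X.toK := AlgHom.ofLinearMap (F.mapLinearMap k) (F.map_id X)
    fun f g ↦ F.map_comp g f
  obtain ⟨r, hr, h₀, h₁⟩ := exists_isIdempotentElem_aeval_end (k := k) φ
  have hre : Φ (aeval φ r) = e := by
    have he' : Φ φ = e := hφ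
    rw [← aeval_algHom_apply, he']
    exact aeval_eq_of_isIdempotentElem (B := End X.toK) he h₀ h₁
  obtain ⟨Y, i, p, hip, hpi⟩ := IsIdempotentComplete.idempotents_split X (aeval φ r) hr
  refine ⟨Y, hX.of_retract ⟨i, p, hip⟩, F.map i, F.map p, ?_, ?_⟩
  · rw [← F.map_comp, hip, F.map_id]
  · rw [← F.map_comp, hpi]
    exact hre

theorem KbProj.exists_split (k : Type v) [Field k] [Algebra k A]
    [FiniteDimensional k A] {T : KCat A} (hT : KbProj A T) (e : T ⟶ T) (he : e ≫ e = e) :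
    ∃ (Y : KCat A) (_ : KbProj A Y) (i : Y ⟶ T) (p : T ⟶ Y), i ≫ p = 𝟙 _ ∧ p ≫ i = e := by
  obtain ⟨X, hX, ⟨α⟩⟩ := hT
  obtain ⟨Y, hY, i, p, hip, hpi⟩ := hX.exists_split k (α.inv ≫ e ≫ α.hom) (by simp [reassoc_of% he])
  refine ⟨Y.toK, hY.kbProj, i ≫ α.inv, α.hom ≫ p, by simpa using hip, ?_⟩
  rw [Category.assoc, reassoc_of% hpi]
  simp

/-- A retract and an object of `K^b(proj A)` splitting the same idempotent are isomorphic. -/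
theorem KbProj.isStableUnderRetracts (k : Type v) [Field k] [Algebra k A]
    [FiniteDimensional k A] : (KbProj A).IsStableUnderRetracts where
  of_retract {T T'} r hT' := by
    obtain ⟨Y, hY, i, p, hip, hpi⟩ := KbProj.exists_split k hT' (r.r ≫ r.i) (by simp)
    refine (KbProj A).prop_of_iso ⟨i ≫ r.r, r.i ≫ p, ?_, ?_⟩ hY
    · rw [Category.assoc, ← Category.assoc r.r, ← hpi]
      simp [hip]
    · rw [Category.assoc, ← Category.assoc p, hpi]
      simp

end KbProj

/-! ### Null-homotopic maps in coordinates. -/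

section Homotopy

variable {A : Type u} [Ring A]

/-- Indexing the homotopy by its target degree `j`, with source degree `j + 1`, keeps later
computations free of transport along equalities of degrees. -/
theorem quotient_map_eq_zero_iff {X Y : Cplx A} (φ : X ⟶ Y) :
    (HomotopyCategory.quotient (ModuleCat.{u} Aᵐᵒᵖ) (ComplexShape.up ℤ)).map φ = 0 ↔
      ∃ s : ∀ j : ℤ, X.X (j + 1) ⟶ Y.X j, ∀ j, φ.f (j + 1) =
        X.d (j + 1) (j + 1 + 1) ≫ s (j + 1) + s j ≫ Y.d j (j + 1) := by
  rw [HomotopyCategory.quotient_map_eq_zero_iff]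
  constructor
  · rintro ⟨h⟩
    refine ⟨fun j ↦ h.hom (j + 1) j, fun j ↦ ?_⟩
    have := h.comm (j + 1)
    rw [dNext_eq h.hom (i' := j + 1 + 1) (by simp), prevD_eq h.hom (j' := j) (by simp)] at this
    simpa using this
  · rintro ⟨s, hs⟩
    let s' : ∀ i j, (ComplexShape.up ℤ).Rel j i → (X.X i ⟶ Y.X j) := fun i j h ↦
      eqToHom (by rw [show i = j + 1 from h.symm]) ≫ s j
    have : φ = Homotopy.nullHomotopicMap' s' := by
      ext1 i
      obtain ⟨j, rfl⟩ : ∃ j, i = j + 1 := ⟨i - 1, by lia⟩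
      rw [Homotopy.nullHomotopicMap'_f (k₂ := j) (k₀ := j + 1 + 1) (by simp) (by simp), hs]
      simp [s']
    rw [this]
    exact ⟨Homotopy.nullHomotopy' s'⟩

end Homotopy

/-! ### The regular module generates `K^b(proj A)` and represents cohomology. -/

section Generator

variable {A : Type u} [Ring A]

theorem FGProj.inAdd_single {M : ModuleCat.{u} Aᵐᵒᵖ} (hM : FGProj M) :
    InAdd (regularCplx A).toK (Cplx.toK ((CochainComplex.singleFunctor _ 0).obj M)) := by
  obtain ⟨m, ξ, x, hx⟩ := hM.exists_dual_basis
  let e : regMod Aᵐᵒᵖ ≅ ModuleCat.of Aᵐᵒᵖ A :=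
    LinearEquiv.toModuleIso
      { (MulOpposite.opAddEquiv (α := A)).symm with
        map_smul' := fun _ _ ↦ rfl }
  let F := HomotopyCategory.singleFunctor (ModuleCat.{u} Aᵐᵒᵖ) 0
  refine inAdd_iff.2 ⟨m, fun j ↦ F.map (ξ j ≫ e.hom), fun j ↦ F.map (e.inv ≫ x j), ?_⟩
  have h : ∑ j, F.map (ξ j ≫ e.hom) ≫ F.map (e.inv ≫ x j) = 𝟙 (F.obj M) := by
    simp only [← F.map_comp, Category.assoc, Iso.hom_inv_id_assoc]
    rw [← F.map_sum, hx, F.map_id]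
  exact h

variable (S : ObjectProperty (KCat A)) [S.IsTriangulated] [S.IsStableUnderRetracts]

theorem FGProj.prop_single (hS : S (regularCplx A).toK) {M : ModuleCat.{u} Aᵐᵒᵖ} (hM : FGProj M)
    (a : ℤ) : S (Cplx.toK ((CochainComplex.singleFunctor _ a).obj M)) := by
  have e := ((HomotopyCategory.singleFunctors (ModuleCat.{u} Aᵐᵒᵖ)).shiftIso (-a) a 0
    (by lia)).app M
  exact S.prop_of_iso e (S.le_shift _ _ (hM.inAdd_single.prop hS))

/-- A complex of projectives with lowest nonzero term in degree `a` is an extension of a stalk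
complex by a shorter complex. -/
theorem exists_stalk_extension {X : Cplx A} {a : ℤ} (ha : IsZero (X.X (a - 1)))
    (hproj : FGProj (X.X a)) :
    ∃ (T : Triangle (KCat A)) (_ : T ∈ distTriang _) (Z : Cplx A), T.obj₁ = Z.toK ∧
      T.obj₂ = X.toK ∧ T.obj₃ = Cplx.toK ((CochainComplex.singleFunctor _ a).obj (X.X a)) ∧
      (∀ i, Nonempty (Retract (Z.X i) (X.X i))) ∧ IsZero (Z.X a) := by
  -- Differentials raise degree, so the lowest term is a quotient complex. Its projectivity splits
  -- the kernel sequence degreewise, which yields the triangle.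
  let f : X ⟶ (CochainComplex.singleFunctor _ a).obj (X.X a) :=
    HomologicalComplex.mkHomToSingle (𝟙 _) fun i hi ↦ by
      obtain rfl : i = a - 1 := by simp at hi; lia
      exact ha.eq_of_src _ _
  have hfa : IsIso (f.f a) := by
    have : f.f a = (HomologicalComplex.singleObjXSelf (ComplexShape.up ℤ) a (X.X a)).inv := by
      rw [HomologicalComplex.mkHomToSingle_f, Category.id_comp]
    rw [this]
    exact (HomologicalComplex.singleObjXSelf (ComplexShape.up ℤ) a (X.X a)).symm.isIso_hom
  have hz : ∀ i, i ≠ a → IsZero (((CochainComplex.singleFunctor _ a).obj (X.X a)).X i) :=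
    fun i hi ↦ HomologicalComplex.isZero_single_obj_X _ _ _ _ hi
  have hf : Epi f := by
    have : ∀ i, Epi (f.f i) := fun i ↦ by
      by_cases hi : i = a
      · subst hi; infer_instance
      · exact ⟨fun g h _ ↦ (hz i hi).eq_of_src _ _⟩
    exact HomologicalComplex.epi_of_epi_f f this
  let E : ShortComplex (Cplx A) := ShortComplex.mk (kernel.ι f) f (kernel.condition f)
  have hE : E.ShortExact :=
    { exact := ShortComplex.exact_kernel f
      mono_f := inferInstanceAs (Mono (kernel.ι f))
      epi_g := hf }
  have hEn : ∀ n, (E.map (HomologicalComplex.eval _ _ n)).ShortExact := fun n ↦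
    hE.map_of_exact _
  have hpr : ∀ n, Projective (E.map (HomologicalComplex.eval _ _ n)).X₃ := fun n ↦ by
    by_cases hn : n = a
    · subst hn
      have : Projective (X.X n) := by
        have := hproj.2
        exact (IsProjective.iff_projective (X.X n)).1 this
      exact Projective.of_iso (@asIso _ _ _ _ (f.f n) hfa) this
    · exact (hz n hn).projective
  let σ : ∀ n, (E.map (HomologicalComplex.eval _ _ n)).Splitting := fun n ↦
    have := hpr n
    (hEn n).splittingOfProjective
  refine ⟨CochainComplex.trianglehOfDegreewiseSplit E σ,
    (HomotopyCategory.distinguished_iff_iso_trianglehOfDegreewiseSplit _).2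
      ⟨E, σ, ⟨Iso.refl _⟩⟩, kernel f, rfl, rfl, rfl,
    fun i ↦ ⟨⟨_, (σ i).r, (σ i).f_r⟩⟩, ?_⟩
  have h0 : (kernel.ι f).f a = 0 := by
    rw [← cancel_mono (f.f a), ← HomologicalComplex.comp_f, kernel.condition, zero_comp]
    rfl
  have h1 : ∃ r : X.X a ⟶ (kernel f).X a, (kernel.ι f).f a ≫ r = 𝟙 _ := ⟨(σ a).r, (σ a).f_r⟩
  obtain ⟨r, hr⟩ := h1
  rw [IsZero.iff_id_eq_zero, ← hr, h0, zero_comp]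

theorem prop_toK_of_bounds (hS : S (regularCplx A).toK) (n : ℕ) : ∀ (a : ℤ) (X : Cplx A),
    (∀ i, i < a ∨ a + n ≤ i → IsZero (X.X i)) → (∀ i, FGProj (X.X i)) → S X.toK := by
  induction n with
  | zero =>
    intro a X h _
    have : IsZero X := by
      rw [IsZero.iff_id_eq_zero]
      ext1 i
      exact (h i (by simpa using lt_or_ge i a)).eq_of_src _ _
    exact S.prop_of_isZero ((HomotopyCategory.quotient _ _).map_isZero this)
  | succ n ih =>
    intro a X h hX
    obtain ⟨T, hT, Z, h₁, h₂, h₃, hZ, hZa⟩ := exists_stalk_extension (h (a - 1) (by lia)) (hX a)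
    rw [← h₂]
    refine S.ext_of_isTriangulatedClosed₂ T hT ?_ ?_
    · rw [h₁]
      refine ih (a + 1) Z (fun i hi ↦ ?_) fun i ↦ (hX i).of_retract (hZ i).some
      by_cases hia : i = a
      · exact hia ▸ hZa
      · have r := (hZ i).some
        rw [IsZero.iff_id_eq_zero, ← r.retract, (h i (by push_cast; lia)).eq_of_tgt r.i 0,
          zero_comp]
    · rw [h₃]
      exact (hX a).prop_single S hS a

/-- The regular module generates `K^b(proj A)`. -/
theorem kbProj_le_of_regularCplx (hS : S (regularCplx A).toK) : KbProj A ≤ S := by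
  rintro T ⟨X, ⟨⟨a, b, h⟩, h'⟩, ⟨e⟩⟩
  refine S.prop_of_iso e.symm (prop_toK_of_bounds S hS (b + 1 - a).toNat a X (fun i hi ↦ ?_) h')
  exact h i (by lia)

theorem isBoundedProj_regularCplx : IsBoundedProj (regularCplx A) := by
  have hz : ∀ i, i ≠ 0 → IsZero ((regularCplx A).X i) :=
    fun i hi ↦ HomologicalComplex.isZero_single_obj_X _ _ _ _ hi
  refine ⟨⟨0, 0, fun i hi ↦ hz i (by lia)⟩, fun i ↦ ?_⟩
  by_cases hi : i = 0
  · subst hi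
    let e : Aᵐᵒᵖ ≃ₗ[Aᵐᵒᵖ] A :=
      { (MulOpposite.opAddEquiv (α := A)).symm with
        map_smul' := fun _ _ ↦ rfl }
    have : FGProj (ModuleCat.of Aᵐᵒᵖ A) := ⟨.equiv e, .of_equiv e⟩
    exact this.of_retract (.ofIso
      (HomologicalComplex.singleObjXSelf (ComplexShape.up ℤ) 0 (ModuleCat.of Aᵐᵒᵖ A)))
  · exact FGProj.of_isZero (hz i hi)

/-- Morphisms in `K(A)` from `A` to a complex without cohomology in degree `0` vanish. -/
theorem regularCplx_hom_eq_zero {Y : Cplx A} (hY : IsZero (Y.homology 0))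
    (f : (regularCplx A).toK ⟶ Y.toK) : f = 0 := by
  obtain ⟨φ, rfl⟩ := (HomotopyCategory.quotient _ _).map_surjective f
  have hproj : Projective (ModuleCat.of Aᵐᵒᵖ A) := by
    let e : Aᵐᵒᵖ ≃ₗ[Aᵐᵒᵖ] A :=
      { (MulOpposite.opAddEquiv (α := A)).symm with
        map_smul' := fun _ _ ↦ rfl }
    have : Module.Projective Aᵐᵒᵖ A := .of_equiv e
    exact (IsProjective.iff_projective A).1 this
  have hp : Projective ((regularCplx A).X 0) :=
    Projective.of_iso (HomologicalComplex.singleObjXSelf (ComplexShape.up ℤ) 0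
      (ModuleCat.of Aᵐᵒᵖ A)).symm hproj
  have hex : (Y.sc' (-1) 0 1).Exact :=
    ((Y.exactAt_iff' (-1) 0 1 (by simp) (by simp)).1
      ((Y.exactAt_iff_isZero_homology 0).2 hY))
  have hXd : ∀ i j, (regularCplx A).d i j = 0 :=
    fun i j ↦ HomologicalComplex.single_obj_d (ComplexShape.up ℤ) 0 _ i j
  have hd : φ.f 0 ≫ Y.d 0 1 = 0 := by
    rw [φ.comm, hXd, zero_comp]
  have h0 : ∃ s : (regularCplx A).X 0 ⟶ Y.X (-1), φ.f 0 = s ≫ Y.d (-1) 0 :=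
    ⟨hex.liftFromProjective (φ.f 0) hd, (hex.liftFromProjective_comp (φ.f 0) hd).symm⟩
  rw [quotient_map_eq_zero_iff]
  have hs : ∀ j : ℤ, ∃ s : (regularCplx A).X (j + 1) ⟶ Y.X j, φ.f (j + 1) = s ≫ Y.d j (j + 1) := by
    intro j
    by_cases hj : j = -1
    · subst hj
      exact h0
    · exact ⟨0, (HomologicalComplex.isZero_single_obj_X _ _ _ _ (by lia)).eq_of_src _ _⟩
  choose s hs using hs
  exact ⟨s, fun j ↦ by rw [hXd, zero_comp, zero_add, hs]⟩

end Generator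

/-! ### Trace forms on finitely generated projective modules. -/

section Trace

variable {k : Type v} [Field k] {R : Type u} [Ring R] [Algebra k R]

/-- The element of `R` by which an endomorphism of the regular module multiplies. -/
def regEval (h : regMod R ⟶ regMod R) : R := (show R →ₗ[R] R from h.hom) 1

theorem regEval_comp (h h' : regMod R ⟶ regMod R) : regEval (h ≫ h') = regEval h * regEval h' := by
  have key : ∀ h h' : R →ₗ[R] R, h' (h 1) = h 1 * h' 1 := fun h h' ↦ by
    rw [← smul_eq_mul, ← map_smul, smul_eq_mul, mul_one]
  exact key h.hom h'.hom

theorem regEval_surjective (b : R) : ∃ c : regMod R ⟶ regMod R, regEval c = b :=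
  ⟨ModuleCat.ofHom (LinearMap.toSpanSingleton R R b), one_mul b⟩

theorem regEval_smul (c : k) (h : regMod R ⟶ regMod R) : regEval (c • h) = c • regEval h :=
  (Algebra.smul_def c (regEval h)).symm

/-- The linear form on the endomorphisms of the regular module given by a linear form on `R`. -/
noncomputable def formEnd (τ : R →ₗ[k] k) : (regMod R ⟶ regMod R) →ₗ[k] k where
  toFun h := τ (regEval h)
  map_add' h h' := map_add τ (regEval h) (regEval h')
  map_smul' c h := by rw [regEval_smul, map_smul, RingHom.id_apply]

open scoped Classical in
/-- The trace of an endomorphism of a finitely generated projective module, associated with a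
linear form on the ring (and `0` on other modules). -/
noncomputable def fgTrace (τ : R →ₗ[k] k) (M : ModuleCat.{u} R) : (M ⟶ M) →ₗ[k] k :=
  if hM : FGProj M then
    ∑ j, formEnd τ ∘ₗ Linear.leftComp k _ (hM.exists_dual_basis.choose_spec.choose_spec.choose j) ∘ₗ
      Linear.rightComp k _ (hM.exists_dual_basis.choose_spec.choose j)
  else 0

theorem FGProj.exists_fgTrace (τ : R →ₗ[k] k) {M : ModuleCat.{u} R} (hM : FGProj M) :
    ∃ (m : ℕ) (ξ : Fin m → (M ⟶ regMod R)) (x : Fin m → (regMod R ⟶ M)),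
      ∑ j, ξ j ≫ x j = 𝟙 M ∧
        ∀ f : M ⟶ M, fgTrace τ M f = ∑ j, formEnd τ (x j ≫ f ≫ ξ j) := by
  refine ⟨_, _, _, hM.exists_dual_basis.choose_spec.choose_spec.choose_spec, fun f ↦ ?_⟩
  rw [fgTrace, dif_pos hM, LinearMap.sum_apply]
  rfl

variable {τ : R →ₗ[k] k}

theorem formEnd_comp_comm (hτ : ∀ a b, τ (a * b) = τ (b * a))
    (h h' : regMod R ⟶ regMod R) :
    formEnd τ (h ≫ h') = formEnd τ (h' ≫ h) := by
  change τ (regEval _) = τ (regEval _)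
  rw [regEval_comp, regEval_comp, hτ]

/-- Inserting the dual bases of `M` and `N` turns both sides into the same double sum, up to
swapping two endomorphisms of the regular module, where the symmetry of `τ` applies. -/
theorem fgTrace_comp_comm (hτ : ∀ a b, τ (a * b) = τ (b * a))
    {M N : ModuleCat.{u} R} (hM : FGProj M) (hN : FGProj N) (f : M ⟶ N)
    (g : N ⟶ M) : fgTrace τ M (f ≫ g) = fgTrace τ N (g ≫ f) := by
  obtain ⟨m, ξ, x, h, ht⟩ := hM.exists_fgTrace τ
  obtain ⟨n, η, y, h', ht'⟩ := hN.exists_fgTrace τ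
  rw [ht, ht']
  have h₁ : ∀ j, x j ≫ (f ≫ g) ≫ ξ j = ∑ i, (x j ≫ f ≫ η i) ≫ (y i ≫ g ≫ ξ j) := fun j ↦ by
    calc _ = x j ≫ f ≫ 𝟙 N ≫ g ≫ ξ j := by simp
      _ = _ := by
        rw [← h']
        simp only [Preadditive.sum_comp, Preadditive.comp_sum, Category.assoc]
  have h₂ : ∀ i, y i ≫ (g ≫ f) ≫ η i = ∑ j, (y i ≫ g ≫ ξ j) ≫ (x j ≫ f ≫ η i) := fun i ↦ by
    calc _ = y i ≫ g ≫ 𝟙 M ≫ f ≫ η i := by simp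
      _ = _ := by
        rw [← h]
        simp only [Preadditive.sum_comp, Preadditive.comp_sum, Category.assoc]
  simp only [h₁, h₂, map_sum]
  rw [Finset.sum_comm]
  exact Finset.sum_congr rfl fun i _ ↦ Finset.sum_congr rfl fun j _ ↦ formEnd_comp_comm hτ _ _

/-- Testing against `η i ≫ c ≫ x j` isolates a single matrix entry of `f` multiplied by an arbitrary
ring element, and `τ` is nondegenerate. -/
theorem eq_zero_of_fgTrace (hτ : ∀ a b, τ (a * b) = τ (b * a))
    (hτ' : ∀ a, (∀ b, τ (a * b) = 0) → a = 0) {M N : ModuleCat.{u} R}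
    (hM : FGProj M) (hN : FGProj N) (f : M ⟶ N) (hf : ∀ g : N ⟶ M, fgTrace τ M (f ≫ g) = 0) :
    f = 0 := by
  obtain ⟨m, ξ, x, h, ht⟩ := hM.exists_fgTrace τ
  obtain ⟨n, η, y, h', -⟩ := hN.exists_fgTrace τ
  have h₁ : ∀ (a : M ⟶ regMod R) (b : regMod R ⟶ M),
      fgTrace τ M (a ≫ b) = formEnd τ (b ≫ a) := fun a b ↦ by
    rw [ht]
    calc ∑ j, formEnd τ (x j ≫ (a ≫ b) ≫ ξ j)
        = ∑ j, formEnd τ ((b ≫ ξ j) ≫ (x j ≫ a)) := by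
          refine Finset.sum_congr rfl fun j _ ↦ ?_
          rw [formEnd_comp_comm hτ]
          simp only [Category.assoc]
      _ = formEnd τ (b ≫ (∑ j, ξ j ≫ x j) ≫ a) := by
          rw [← map_sum]
          simp only [Preadditive.sum_comp, Preadditive.comp_sum, Category.assoc]
      _ = _ := by rw [h, Category.id_comp]
  have h₂ : ∀ j i, x j ≫ f ≫ η i = 0 := fun j i ↦ by
    have h₃ : ∀ c : regMod R ⟶ regMod R,
        formEnd τ ((x j ≫ f ≫ η i) ≫ c) = 0 := fun c ↦ by
      have := hf (η i ≫ c ≫ x j)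
      rw [show f ≫ η i ≫ c ≫ x j = (f ≫ η i ≫ c) ≫ x j by simp, h₁] at this
      simpa using this
    have h₄ : regEval (x j ≫ f ≫ η i) = 0 := by
      refine hτ' _ fun b ↦ ?_
      obtain ⟨c, rfl⟩ := regEval_surjective b
      rw [← regEval_comp]
      exact h₃ _
    ext1
    exact LinearMap.ext_ring h₄
  calc f = 𝟙 M ≫ f ≫ 𝟙 N := by simp
    _ = 0 := by
      rw [← h, ← h']
      simp only [Preadditive.sum_comp, Preadditive.comp_sum, Category.assoc]
      refine Finset.sum_eq_zero fun i _ ↦ Finset.sum_eq_zero fun j _ ↦ ?_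
      rw [← Category.assoc f, ← Category.assoc (x _), h₂, zero_comp, comp_zero]

/-- The trace pairing is injective from either side, so `Hom(M, N)` and `Hom(N, M)` have equal
dimension and the pairing is perfect. -/
theorem exists_fgTrace_eq [FiniteDimensional k R] (hτ : ∀ a b, τ (a * b) = τ (b * a))
    (hτ' : ∀ a, (∀ b, τ (a * b) = 0) → a = 0)
    {M N : ModuleCat.{u} R} (hM : FGProj M) (hN : FGProj N) (ψ : (N ⟶ M) →ₗ[k] k) :
    ∃ f : M ⟶ N, ∀ g, ψ g = fgTrace τ M (f ≫ g) := by
  have := hM.finiteDimensional_hom (k := k) hN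
  have := hN.finiteDimensional_hom (k := k) hM
  let L : ∀ M N : ModuleCat.{u} R, (M ⟶ N) →ₗ[k] Module.Dual k (N ⟶ M) := fun M N ↦
    LinearMap.mk₂ k (fun f g ↦ fgTrace τ M (f ≫ g)) (fun f f' g ↦ by simp) (fun c f g ↦ by simp)
      (fun f g g' ↦ by simp) (fun c f g ↦ by simp)
  have hL : ∀ {M N : ModuleCat.{u} R}, FGProj M → FGProj N → Function.Injective (L M N) := by
    intro M N hM hN
    rw [injective_iff_map_eq_zero]
    exact fun f hf ↦ eq_zero_of_fgTrace hτ hτ' hM hN f fun g ↦ LinearMap.congr_fun hf g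
  have h₁ := LinearMap.finrank_le_finrank_of_injective (hL hM hN)
  have h₂ := LinearMap.finrank_le_finrank_of_injective (hL hN hM)
  rw [Subspace.dual_finrank_eq] at h₁ h₂
  obtain ⟨f, hf⟩ := (LinearMap.injective_iff_surjective_of_finrank_eq_finrank
    (by rw [Subspace.dual_finrank_eq]; exact le_antisymm h₁ h₂)).1 (hL hM hN) ψ
  exact ⟨f, fun g ↦ (LinearMap.congr_fun hf g).symm⟩

end Trace

/-! ### Symmetry of Hom-vanishing over a symmetric algebra. -/

section Duality

variable {k : Type v} [Field k] {A : Type u} [Ring A] [Algebra k A]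

theorem sum_Ioc_telescope {G : Type*} [AddCommGroup G] (e : ℤ → G) (a : ℤ) (n : ℕ) :
    ∑ i ∈ Finset.Ioc a (a + n), (e i - e (i - 1)) = e (a + n) - e a := by
  induction n with
  | zero => simp
  | succ n ih =>
    have : Finset.Ioc a (a + (n + 1 : ℕ)) = insert (a + n + 1) (Finset.Ioc a (a + n)) := by
      ext i
      simp only [Finset.mem_Ioc, Finset.mem_insert]
      lia
    rw [this, Finset.sum_insert (by simp), ih]
    push_cast
    rw [add_sub_cancel_right, ← add_assoc]
    abel

/-- The degreewise morphisms `X ⟶ Y` of the form `d s + s d`. -/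
def nullHomotopicSubmodule (k : Type v) [Field k] [Algebra k A] (X Y : Cplx A) :
    Submodule k (∀ i : ℤ, X.X i ⟶ Y.X i) where
  carrier := {w | ∃ s : ∀ j : ℤ, X.X (j + 1) ⟶ Y.X j, ∀ j, w (j + 1) =
    X.d (j + 1) (j + 1 + 1) ≫ s (j + 1) + s j ≫ Y.d j (j + 1)}
  add_mem' := by
    rintro w w' ⟨s, hs⟩ ⟨s', hs'⟩
    refine ⟨fun j ↦ s j + s' j, fun j ↦ ?_⟩
    rw [Pi.add_apply, hs, hs', Preadditive.comp_add, Preadditive.add_comp]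
    abel
  zero_mem' := ⟨fun _ ↦ 0, fun j ↦ by simp⟩
  smul_mem' := by
    rintro c w ⟨s, hs⟩
    refine ⟨fun j ↦ c • s j, fun j ↦ ?_⟩
    rw [Pi.smul_apply, hs, smul_add, Linear.comp_smul, Linear.smul_comp]

/-- A homotopy with one nonzero component affects just two adjacent degrees. These are the test
elements from which a linear form killing null-homotopic maps yields a chain map. -/
theorem single_add_single_mem (X Y : Cplx A) (p : ℤ) (h : X.X (p + 1) ⟶ Y.X p) :
    (Pi.single (M := fun i : ℤ ↦ (X.X i ⟶ Y.X i)) p (X.d p (p + 1) ≫ h) +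
      Pi.single (M := fun i : ℤ ↦ (X.X i ⟶ Y.X i)) (p + 1) (h ≫ Y.d p (p + 1))) ∈ nullHomotopicSubmodule k X Y := by
  refine ⟨Pi.single (M := fun j : ℤ ↦ (X.X (j + 1) ⟶ Y.X j)) p h, fun j ↦ ?_⟩
  rw [Pi.add_apply]
  rcases eq_or_ne j p with rfl | hj
  · rw [Pi.single_eq_of_ne (by lia), Pi.single_eq_same, Pi.single_eq_of_ne (by lia),
      Pi.single_eq_same, comp_zero]
  · rw [Pi.single_eq_of_ne (i := p + 1) (by lia), Pi.single_eq_of_ne (i := p) (i' := j) hj,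
      zero_comp]
    congr 1
    rcases eq_or_ne (j + 1) p with rfl | hj'
    · rw [Pi.single_eq_same, Pi.single_eq_same]
    · rw [Pi.single_eq_of_ne hj', Pi.single_eq_of_ne hj', comp_zero]

/-- For a symmetric algebra, `Hom(X, Y) = 0` implies `Hom(Y, X) = 0` in `K^b(proj A)`. -/
theorem IsBoundedProj.hom_eq_zero_symm [FiniteDimensional k A]
    {τ : Aᵐᵒᵖ →ₗ[k] k} (hτ : ∀ a b, τ (a * b) = τ (b * a))
    (hτ' : ∀ a, (∀ b, τ (a * b) = 0) → a = 0) {X Y : Cplx A} (hX : IsBoundedProj X)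
    (hY : IsBoundedProj Y) (hXY : ∀ f : X.toK ⟶ Y.toK, f = 0) (g : Y.toK ⟶ X.toK) : g = 0 := by
  obtain ⟨g, rfl⟩ := (HomotopyCategory.quotient _ _).map_surjective g
  rw [quotient_map_eq_zero_iff]
  by_contra hg
  have hg' : g.f ∉ nullHomotopicSubmodule k Y X := hg
  -- A linear form separating `g` from the null-homotopic maps is represented degreewise, via the
  -- trace, by maps `f i : X.X i ⟶ Y.X i`. These will form a chain map `X ⟶ Y` up to signs, and its
  -- null-homotopy will contradict `ψ g ≠ 0`.
  obtain ⟨ψ, hψg, hψ⟩ := Submodule.exists_le_ker_of_notMem hg'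
  have hf : ∀ i, ∃ f : X.X i ⟶ Y.X i, ∀ u, ψ (Pi.single i u) = fgTrace τ (X.X i) (f ≫ u) :=
    fun i ↦ exists_fgTrace_eq hτ hτ' (hX.fgProj i) (hY.fgProj i)
      (ψ ∘ₗ LinearMap.single k (fun i : ℤ ↦ (Y.X i ⟶ X.X i)) i)
  choose f hf using hf
  have hcomm : ∀ p : ℤ, f p ≫ Y.d p (p + 1) + X.d p (p + 1) ≫ f (p + 1) = 0 := by
    intro p
    refine eq_zero_of_fgTrace hτ hτ' (hX.fgProj p) (hY.fgProj (p + 1)) _ fun h ↦ ?_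
    have h₁ : ψ _ = 0 := hψ (single_add_single_mem Y X p h)
    rw [map_add, hf, hf, ← Category.assoc (f (p + 1)),
      fgTrace_comp_comm hτ (hX.fgProj _) (hX.fgProj _)] at h₁
    rw [Preadditive.add_comp, map_add, ← h₁]
    simp only [Category.assoc]
  -- The `f i` anticommute with the differentials, which the sign `(-1)^i` corrects.
  let F : X ⟶ Y :=
    { f := fun i ↦ i.negOnePow • f i
      comm' := by
        rintro i _ rfl
        rw [Linear.units_smul_comp, Linear.comp_units_smul, Int.negOnePow_succ, Units.neg_smul,
          ← smul_neg, eq_neg_of_add_eq_zero_left (hcomm i)] }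
  obtain ⟨s, hs⟩ := (quotient_map_eq_zero_iff F).1 (hXY _)
  have hfs : ∀ j : ℤ, f (j + 1) = (j + 1).negOnePow •
      (X.d (j + 1) (j + 1 + 1) ≫ s (j + 1) + s j ≫ Y.d j (j + 1)) := by
    intro j
    rw [← hs]
    change _ = (j + 1).negOnePow • (j + 1).negOnePow • f (j + 1)
    rw [smul_smul, Int.units_mul_self, one_smul]
  let c : ℤ → k := fun j ↦ fgTrace τ (X.X j) (X.d j (j + 1) ≫ s j ≫ g.f j)
  have hu : ∀ (M : ModuleCat.{u} Aᵐᵒᵖ) (u : ℤˣ) (x : M ⟶ M),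
      fgTrace τ M (u • x) = u • fgTrace τ M x := fun M u x ↦ by
    rw [Units.smul_def, map_zsmul, ← Units.smul_def]
  -- Cyclicity of the trace and `g` being a chain map make the alternating sum telescope.
  have hterm : ∀ i : ℤ, fgTrace τ (X.X i) (f i ≫ g.f i) =
      i.negOnePow • c i - (i - 1).negOnePow • c (i - 1) := by
    intro i
    obtain ⟨j, rfl⟩ : ∃ j, i = j + 1 := ⟨i - 1, by lia⟩
    rw [add_sub_cancel_right, hfs, Linear.units_smul_comp, Int.negOnePow_succ, Units.neg_smul,
      Units.neg_smul, map_neg, hu, Preadditive.add_comp, map_add, smul_add]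
    have h₁ : (s j ≫ Y.d j (j + 1)) ≫ g.f (j + 1) = (s j ≫ g.f j) ≫ X.d j (j + 1) := by
      simp
    rw [h₁, fgTrace_comp_comm hτ (hX.fgProj _) (hX.fgProj _)]
    simp only [c, Category.assoc]
    abel
  obtain ⟨a, b, h⟩ := hX.1
  have hc : ∀ j, j < a ∨ b < j → c j = 0 := fun j hj ↦ by
    simp only [c]
    rw [(h j hj).eq_of_src (X.d j (j + 1)) 0, zero_comp, map_zero]
  -- The interval covers the support `[a, b]` of `X`, and both of its ends lie outside it, so the
  -- telescoped boundary terms vanish.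
  have hgsum : g.f = ∑ i ∈ Finset.Ioc (a - 1) (a - 1 + (b + 2 - a).toNat),
      Pi.single i (g.f i) := by
    funext i
    rw [Finset.sum_apply]
    by_cases hi : i ∈ Finset.Ioc (a - 1) (a - 1 + (b + 2 - a).toNat)
    · rw [Finset.sum_eq_single_of_mem i hi fun j _ hj ↦ Pi.single_eq_of_ne hj.symm _,
        Pi.single_eq_same]
    · refine (h i ?_).eq_of_tgt _ _
      rw [Finset.mem_Ioc] at hi
      lia
  apply hψg
  rw [hgsum, map_sum]
  simp only [hf, hterm]
  rw [sum_Ioc_telescope (fun i ↦ i.negOnePow • c i), hc _ (by lia), hc _ (by lia), smul_zero,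
    smul_zero, sub_zero]

/-- The form is the image of `1` under the bimodule isomorphism: left and right linearity give
symmetry, injectivity gives nondegeneracy. -/
theorem IsSymmetricAlg.exists_form (hA : IsSymmetricAlg k A) : ∃ τ : Aᵐᵒᵖ →ₗ[k] k,
    (∀ a b, τ (a * b) = τ (b * a)) ∧ ∀ a, (∀ b, τ (a * b) = 0) → a = 0 := by
  obtain ⟨φ, hφ⟩ := hA
  have h₁ : ∀ a y, φ a y = φ 1 (y * a) := fun a y ↦ by simpa using hφ a 1 1 y
  have h₂ : ∀ a y, φ a y = φ 1 (a * y) := fun a y ↦ by simpa using hφ 1 1 a y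
  refine ⟨φ 1 ∘ₗ (MulOpposite.opLinearEquiv k).symm.toLinearMap, fun a b ↦ ?_, fun a ha ↦ ?_⟩
  · change φ 1 (b.unop * a.unop) = φ 1 (a.unop * b.unop)
    rw [← h₁, ← h₂]
  · have h₃ : φ a.unop = 0 := LinearMap.ext fun y ↦ by
      rw [h₁]
      exact ha (MulOpposite.op y)
    rw [← MulOpposite.unop_eq_zero_iff]
    exact φ.injective (h₃.trans (map_zero φ).symm)

theorem KbProj.hom_eq_zero_symm [FiniteDimensional k A] (hA : IsSymmetricAlg k A) {T T' : KCat A} (hT : KbProj A T)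
    (hT' : KbProj A T') (h : ∀ f : T ⟶ T', f = 0) (g : T' ⟶ T) : g = 0 := by
  obtain ⟨τ, hτ, hτ'⟩ := hA.exists_form
  obtain ⟨X, hX, ⟨e⟩⟩ := hT
  obtain ⟨Y, hY, ⟨e'⟩⟩ := hT'
  exact homs_eq_zero_of_iso e'.symm e.symm
    (hX.hom_eq_zero_symm hτ hτ' hY (homs_eq_zero_of_iso e e' h)) g

end Duality

/-! ### Tilting complexes from `Δₙ`. -/

section Tilting

variable {A : Type u} [Ring A]

/-- This is the vanishing part of `Hom(A, P[i]) = H^i(P)`; through it the length of `P` enters the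
argument. -/
theorem homZero_regularCplx {P : Cplx A} {i : ℤ} (h : i ∉ cohomologySupport P) :
    HomZero (regularCplx A).toK P.toK i := by
  have h' : IsZero ((P⟦i⟧).homology 0) :=
    (not_not.1 h).of_iso ((((HomologicalComplex.homologyFunctor (ModuleCat.{u} Aᵐᵒᵖ)
      (ComplexShape.up ℤ) 0).shiftIso i 0 i (by lia)).app P))
  exact homs_eq_zero_of_iso (Iso.refl _)
    (((HomotopyCategory.quotient _ _).commShiftIso i).app P)
    (regularCplx_hom_eq_zero h')

theorem homZero_regularCplx_self {j : ℤ} (hj : j ≠ 0) :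
    HomZero (regularCplx A).toK (regularCplx A).toK j :=
  homZero_regularCplx fun h ↦ h (by
    rw [← HomologicalComplex.exactAt_iff_isZero_homology]
    exact HomologicalComplex.exactAt_single_obj _ _ _ _ hj)

/-- A direct sum `X ⊞ P⟦m⟧` is tilting if all relevant morphisms vanish and it generates `A`. -/
theorem isTilting_biprod {X P : KCat A} {m : ℤ} (hX : KbProj A X) (hP : KbProj A P)
    (hXX : ∀ j, j ≠ 0 → HomZero X X j) (hPP : ∀ j, j ≠ 0 → HomZero P P j)
    (hPX : ∀ j, j ≠ -m → HomZero P X j) (hXP : ∀ j, j ≠ m → HomZero X P j)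
    (hgen : ∀ S : ObjectProperty (KCat A), S.IsTriangulated → S.IsStableUnderRetracts →
      S P → S X → S (regularCplx A).toK) : IsTilting (X ⊞ P⟦m⟧) := by
  refine ⟨⟨(KbProj A).ext_of_isTriangulatedClosed₂ _ (binaryBiproductTriangle_distinguished _ _)
    hX ((KbProj A).le_shift m _ hP), fun n hn ↦ ?_⟩, ?_⟩
  · refine HomZero.biprod_left (HomZero.biprod_right (hXX n hn) ?_)
      (HomZero.biprod_right ?_ ?_)
    · exact (homZero_shift_right_iff rfl).2 (hXP _ (by lia))
    · exact (homZero_shift_left_iff (c := n - m) (by lia)).2 (hPX _ (by lia))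
    · exact (homZero_shift_left_iff (c := n - m) (by lia)).2
        ((homZero_shift_right_iff rfl).2 (hPP _ (by lia)))
  · have hT := (ObjectProperty.singleton (X ⊞ P⟦m⟧)).le_triangEnvelope _
      ((ObjectProperty.singleton_iff _ _).2 rfl)
    set S := (ObjectProperty.singleton (X ⊞ P⟦m⟧)).triangEnvelope
    have hSX : S X := S.prop_of_retract ⟨biprod.inl, biprod.fst, biprod.inl_fst⟩ hT
    have hSP : S (P⟦m⟧) := S.prop_of_retract ⟨biprod.inr, biprod.snd, biprod.inr_snd⟩ hT
    have hSP' : S P := S.prop_of_iso ((shiftFunctorCompIsoId (KCat A) m (-m) (by lia)).app P)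
      (S.le_shift (-m) _ hSP)
    exact kbProj_le_of_regularCplx S (hgen S inferInstance inferInstance hSP' hSX)

theorem IsTilting.of_iso {T T' : KCat A} (h : IsTilting T) (e : T ≅ T') : IsTilting T' := by
  refine ⟨⟨(KbProj A).prop_of_iso e h.1.1, fun n hn ↦ HomZero.of_iso (h.1.2 n hn) e e⟩,
    h.2.trans ?_⟩
  refine (ObjectProperty.triangEnvelope_le_iff _).2 ?_
  rintro _ ⟨⟩
  exact ObjectProperty.prop_of_iso _ e.symm
    ((ObjectProperty.singleton T').le_triangEnvelope _ ((ObjectProperty.singleton_iff _ _).2 rfl))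

variable {k : Type v} [Field k] [Algebra k A] [FiniteDimensional k A]

/-- The invariants apply with `M = A`: the two degrees allowed for `Hom(P, A[j])` are the negatives
of those in the support of `P`, by duality. A further use of duality bounds `Hom(Δₙ, P[j])`. -/
theorem IsDelta.tilting_conditions (hA : IsSymmetricAlg k A) {P : Cplx A} (hP : IsBoundedProj P)
    (hPT : IsPartialTilting P.toK) {s : ℤ} (hs : ∀ j ∈ cohomologySupport P, j = s ∨ j = s - 1)
    {n : ℕ} {X : KCat A} (hX : IsDelta P.toK s 1 (regularCplx A).toK n X) :
    KbProj A X ∧ (∀ j, j ≠ 0 → HomZero X X j) ∧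
      (1 ≤ n → ∀ j, j ≠ 1 - s - n → HomZero P.toK X j) ∧
      (1 ≤ n → ∀ j, j ≠ n + s - 1 → HomZero X P.toK j) ∧
      ∀ S : ObjectProperty (KCat A), S.IsTriangulated → S.IsStableUnderRetracts →
        S P.toK → S X → S (regularCplx A).toK := by
  have := KbProj.isStableUnderRetracts (A := A) k
  have dual : ∀ {X Y : KCat A}, KbProj A X → KbProj A Y → ∀ {i j : ℤ}, i + j = 0 →
      HomZero X Y i → HomZero Y X j := by
    intro X Y hX hY i j hij h
    rw [← homs_shift_eq_zero_iff hij] at h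
    exact KbProj.hom_eq_zero_symm hA ((KbProj A).le_shift j _ hX) hY h
  obtain ⟨h₁, h₂, h₃, h₄⟩ := hX.invariants
    (fun X Y hX hY ↦ KbProj.hom_eq_zero_symm hA hX hY) hP.kbProj
    isBoundedProj_regularCplx.kbProj hPT.2 (fun j hj ↦ homZero_regularCplx_self hj)
    (fun j hj hj' ↦ dual isBoundedProj_regularCplx.kbProj hP.kbProj (i := -j) (by lia)
      (homZero_regularCplx fun h ↦ by have := hs _ h; lia))
  refine ⟨h₁, h₂, fun hn j hj ↦ h₃ j hj (by lia), fun hn j hj ↦ ?_, h₄⟩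
  exact dual hP.kbProj h₁ (i := -j) (by lia) (h₃ _ (by lia) (by lia))

theorem exists_isDelta (k : Type v) [Field k] [Algebra k A] [FiniteDimensional k A]
    (hA : IsSymmetricAlg k A) {P : Cplx A} (hP : IsBoundedProj P)
    (hPT : IsPartialTilting P.toK) {s : ℤ} (hs : ∀ j ∈ cohomologySupport P, j = s ∨ j = s - 1)
    (n : ℕ) : ∃ X : KCat A, IsDelta P.toK s 1 (regularCplx A).toK n X := by
  have := KbProj.isStableUnderRetracts (A := A) k
  have hadd : ∀ Q, InAdd P.toK Q → KbProj A Q := fun Q hQ ↦ hQ.prop hP.kbProj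
  induction n with
  | zero => exact ⟨_, .zero⟩
  | succ n ih =>
    obtain ⟨X, hX⟩ := ih
    have hKX : KbProj A (X⟦1 - s - (n : ℤ)⟧) :=
      (KbProj A).le_shift _ _ (hX.tilting_conditions hA hP hPT hs).1
    have := hP.kbProj.finiteDimensional_hom k hKX
    obtain ⟨Q, g', hQ, hg'⟩ := exists_projectiveCover (k := k) (P := P.toK)
      (X := X⟦1 - s - (n : ℤ)⟧)
      (fun Q hQ ↦ (hadd Q hQ).finiteDimensional_hom k (hadd Q hQ))
      (fun Q hQ ↦ hP.kbProj.finiteDimensional_hom k (hadd Q hQ))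
      (fun Q e hQ he ↦ by
        obtain ⟨Y, -, h⟩ := (hadd Q hQ).exists_split k e he
        exact ⟨Y, h⟩)
    obtain ⟨Y, h, δ, hT⟩ := distinguished_cocone_triangle (g'⟦(n : ℤ) + s - 1⟧' ≫
      (shiftFunctorCompIsoId (KCat A) (1 - s - (n : ℤ)) ((n : ℤ) + s - 1) (by ring)).hom.app X)
    exact ⟨Y, .succ n X Y Q hX hQ g' hg' _ rfl h δ hT⟩

end Tilting

theorem mainTheorem9 {k : Type v} {A : Type u} [Field k] [Ring A] [Algebra k A]
    [FiniteDimensional k A] (hA : IsSymmetricAlg k A)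
    (P : Cplx A) (hP : IsBoundedProj P) (hPT : IsPartialTilting P.toK) (hlen : HasLength P 2) :
    (∃ Q : KCat A, KbProj A Q ∧ IsTilting (P.toK ⊞ Q)) ∧
    ∀ s : ℤ, IsGreatest (cohomologySupport P) s → ∀ n : ℕ, 1 ≤ n →
      (∃ T : KCat A, IsTheta P.toK s 1 (regularCplx A).toK n T) ∧
      ∀ T : KCat A, IsTheta P.toK s 1 (regularCplx A).toK n T → IsTilting T := by
  obtain ⟨a, b, ha, hb, hab⟩ := hlen
  have hsupp : ∀ j ∈ cohomologySupport P, j = b ∨ j = b - 1 := fun j hj ↦ by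
    have h₁ := ha.2 hj
    have h₂ := hb.2 hj
    lia
  have hPP : ∀ j, j ≠ 0 → HomZero P.toK P.toK j := hPT.2
  refine ⟨?_, fun s hs n hn ↦ ?_⟩
  · obtain ⟨X, hX⟩ := exists_isDelta k hA hP hPT hsupp 1
    obtain ⟨h₁, h₂, h₃, h₄, h₅⟩ := hX.tilting_conditions hA hP hPT hsupp
    -- For `n = 1` one has `Θ₁ = Δ₁ ⊕ P[b]`; shifting by `-b` puts the summand `P` in its original
    -- position.
    refine ⟨X⟦-b⟧, (KbProj A).le_shift _ _ h₁, ?_⟩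
    have : IsTilting (X⟦-b⟧ ⊞ P.toK⟦(0 : ℤ)⟧) := by
      refine isTilting_biprod ((KbProj A).le_shift _ _ h₁) hP.kbProj (fun j hj ↦ ?_) hPP
        (fun j hj ↦ ?_) (fun j hj ↦ ?_) fun S hS hS' hSP hSX ↦ h₅ S hS hS' hSP ?_
      · exact (homZero_shift_left_iff (c := j + b) (by lia)).2
          ((homZero_shift_right_iff (c := j) (by lia)).2 (h₂ j hj))
      · exact (homZero_shift_right_iff rfl).2 (h₃ le_rfl _ (by push_cast; lia))
      · exact (homZero_shift_left_iff (c := j + b) (by lia)).2 (h₄ le_rfl _ (by push_cast; lia))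
      · exact S.prop_of_iso ((shiftFunctorCompIsoId (KCat A) (-b) b (by lia)).app X)
          (S.le_shift b _ hSX)
    exact this.of_iso ((biprod.mapIso (Iso.refl _) ((shiftFunctorZero (KCat A) ℤ).app P.toK)) ≪≫
      biprod.braiding _ _)
  · obtain rfl : s = b := hs.unique hb
    refine ⟨?_, ?_⟩
    · obtain ⟨X, hX⟩ := exists_isDelta k hA hP hPT hsupp n
      exact ⟨_, X, hX, rfl⟩
    · rintro T ⟨X, hX, rfl⟩
      obtain ⟨h₁, h₂, h₃, h₄, h₅⟩ := hX.tilting_conditions hA hP hPT hsupp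
      exact isTilting_biprod h₁ hP.kbProj h₂ hPP (fun j hj ↦ h₃ hn j (by lia)) (h₄ hn) h₅
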